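/- Let $P_0$ be a probability distribution on $[0,1]$, and write $\bar P(x)=\mathbb P_{\tilde v\sim P}(\tilde v>x)$ and $d(P,P_0)=\int_0^1|\bar P(x)-\bar P_0(x)|\,dx$ (the type-1 Wasserstein distance) for distributions $P$ on $[0,1]$. A mechanism is a pair $(q,m):[0,1]\to[0,1]\times\mathbb R$ with $q(v)v-m(v)\ge 0$ and $q(v)v-m(v)\ge q(\omega)v-m(\omega)$ for all $v,\omega\in[0,1]$. For a target revenue $\tau$, the robust satisficing (RS) problem is to minimize $k$ over mechanisms $(q,m)$ and $k>0$ subject to $\tau-\mathbb E_P[m(\tilde v)]\le k\,d(P,P_0)$ for all distributions $P$ on $[0,1]$. Let $\Pi_0=\max_{x\in[0,1]}x\,\mathbb P_{P_0}(\tilde v\ge x)$ and, for $k>0$ and $\pi\in[0,\Pi_0]$, let $$\rho(\pi,k)=\pi+k\int_0^1\Big(\bar P_0(x)-\frac{\pi}{x}\Big)^+dx,\qquad \rho^*(k)=\min_{\pi\in[0,\Pi_0]}\rho(\pi,k),\qquad \pi^*(k)=\operatorname*{argmin}_{\pi\in[0,\Pi_0]}\rho(\pi,k).$$ **Theorem (Optimal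 RS mechanism).** Let $0<\tau<\Pi_0$. There is exactly one $k^*>0$ with $\rho^*(k^*)=\tau$, that is, $k^*=(\rho^*)^{-1}(\tau)$, and the minimizer $\pi^*=\pi^*(k^*)$ is unique. Suppose that $\{x\in(0,1]:\bar P_0(x)=\pi^*/x\}$ has Lebesgue measure zero, and that there are finitely many disjoint intervals $[u_j,w_j)$, $0\le u_1<w_1\le u_2<w_2\le\dots\le u_J<w_J\le1$, with $x\bar P_0(x)\ge\pi^*$ on their union and $x\bar P_0(x)\le\pi^*$ on the rest of $[0,1]$. Put $w_0=u_0=0$ and $u_{J+1}=1$, and define $$(q^*(v),m^*(v))=\begin{cases}k^*\Big(\sum_{i=1}^{j-1}\ln\frac{w_i}{u_i}+\ln\frac{v}{u_j},\ \sum_{i=1}^{j-1}(w_i-u_i)+(v-u_j)\Big), & v\in[u_j,w_j),\ 1\le j\le J,\\[4pt] k^*\Big(\sum_{i=1}^{j}\ln\frac{w_i}{u_i},\ \sum_{i=1}^{j}(w_i-u_i)\Big), & v\in[w_j,u_{j+1}),\ 0\le j\le J,\end{cases}$$ and $(q^*(1),m^*(1))=\big(1,\,k^*\sum_{i=1}^{J}(w_i-u_i)\big)$.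 Then $(q^*,m^*)$ is a mechanism, and $((q^*,m^*),k^*)$ is an optimal solution of the RS problem, so that $k^*$ is its optimal value. Moreover $(q^*,m^*)$ is a randomized posted price: the function $\frac{k^*}{x}\mathbf 1\big(x\in\bigcup_{j}[u_j,w_j)\big)$ is a probability density, and for a price $\tilde p$ with this density $q^*(v)=\mathbb E[\mathbf 1(v\ge\tilde p)]$ and $m^*(v)=\mathbb E[\tilde p\,\mathbf 1(v\ge\tilde p)]$ for all $v\in[0,1]$. -/

import Mathlib

open MeasureTheory Set

noncomputable section

namespace RobustSatisficing

/-- `P` is a probability distribution on the valuation space `[0,1]`. -/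
structure IsValuationLaw (P : Measure ℝ) : Prop where
  prob : IsProbabilityMeasure P
  supp : P (Icc (0 : ℝ) 1)ᶜ = 0

/-- The complementary cumulative distribution function `P̄(x) = ℙ(ṽ > x)`. -/
def ccdf (P : Measure ℝ) (x : ℝ) : ℝ := P.real (Ioi x)

/-- The type-1 Wasserstein distance `d(P, P₀) = ∫₀¹ |P̄(x) - P̄₀(x)| dx`. -/
def wdist (P P0 : Measure ℝ) : ℝ := ∫ x in (0 : ℝ)..1, |ccdf P x - ccdf P0 x|

/-- Direct mechanisms `(q, m) : [0,1] → [0,1] × ℝ` that are individually rational and incentive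
compatible. Values outside `[0,1]` play no role. -/
structure IsMechanism (q m : ℝ → ℝ) : Prop where
  alloc_mem : ∀ v ∈ Icc (0 : ℝ) 1, q v ∈ Icc (0 : ℝ) 1
  ir : ∀ v ∈ Icc (0 : ℝ) 1, 0 ≤ q v * v - m v
  ic : ∀ v ∈ Icc (0 : ℝ) 1, ∀ ω ∈ Icc (0 : ℝ) 1, q ω * v - m ω ≤ q v * v - m v

/-- Feasibility of `((q, m), k)` in the robust satisficing problem with reference law `P0` and
revenue target `τ`. (Payment rules of mechanisms are monotone and bounded on `[0,1]`, so the
expectation is that of an integrable function.) -/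
structure IsFeasible (P0 : Measure ℝ) (τ : ℝ) (q m : ℝ → ℝ) (k : ℝ) : Prop where
  mech : IsMechanism q m
  pos : 0 < k
  satisficing : ∀ P : Measure ℝ, IsValuationLaw P → τ - ∫ v, m v ∂P ≤ k * wdist P P0

/-- `((q, m), k)` is an optimal solution of the robust satisficing problem: it is feasible, and
no feasible point has smaller fragility. -/
def IsOptimal (P0 : Measure ℝ) (τ : ℝ) (q m : ℝ → ℝ) (k : ℝ) : Prop :=
  IsFeasible P0 τ q m k ∧ ∀ q' m' k', IsFeasible P0 τ q' m' k' → k ≤ k'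

/-- Expected revenue `x * ℙ(ṽ ≥ x)` of the posted price `x`. -/
def revenue (P : Measure ℝ) (x : ℝ) : ℝ := x * P.real (Ici x)

/-- `Π₀`, the maximal posted-price revenue over prices in `[0,1]`. -/
def maxRevenue (P0 : Measure ℝ) : ℝ := sSup (revenue P0 '' Icc 0 1)

/-- `d(π) = ∫₀¹ (P̄₀(x) - π/x)⁺ dx`. -/
def isoDist (P0 : Measure ℝ) (π : ℝ) : ℝ := ∫ x in (0 : ℝ)..1, max (ccdf P0 x - π / x) 0

/-- The fragility-adjusted revenue `ρ(π, k) = π + k * d(π)`. -/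
def fragRevenue (P0 : Measure ℝ) (π k : ℝ) : ℝ := π + k * isoDist P0 π

/-- `ρ*(k)`, the minimum of `ρ(·, k)` over `[0, Π₀]`. -/
def minFragRevenue (P0 : Measure ℝ) (k : ℝ) : ℝ :=
  sInf ((fun π => fragRevenue P0 π k) '' Icc 0 (maxRevenue P0))

/-- `π = π*(k)`: the point `π` is the unique minimizer of `ρ(·, k)` over `[0, Π₀]`. -/
def IsUniqueArgmin (P0 : Measure ℝ) (k π : ℝ) : Prop :=
  π ∈ Icc 0 (maxRevenue P0) ∧
    ∀ π' ∈ Icc 0 (maxRevenue P0), π' ≠ π → fragRevenue P0 π k < fragRevenue P0 π' k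

/-- The union `⋃_{1 ≤ j ≤ J} [u_j, w_j)`. -/
def intervalUnion (J : ℕ) (u w : ℕ → ℝ) : Set ℝ := ⋃ j ∈ Finset.Icc 1 J, Ico (u j) (w j)

/-- Finitely many disjoint intervals `[u_j, w_j)`, `1 ≤ j ≤ J`, listed from left to right, on which
`P̄₀(x) ≥ π/x` and off which `P̄₀(x) ≤ π/x`, with the conventions `u_0 = w_0 = 0`, `u_{J+1} = 1`.
The inequalities are multiplied by `x`, to be meaningful at `x = 0` also. -/
structure IsIsoRevenueIntervals (P0 : Measure ℝ) (π : ℝ) (J : ℕ) (u w : ℕ → ℝ) : Prop where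
  u_zero : u 0 = 0
  w_zero : w 0 = 0
  u_last : u (J + 1) = 1
  u_lt_w : ∀ j ∈ Finset.Icc 1 J, u j < w j
  w_le_u : ∀ j ≤ J, w j ≤ u (j + 1)
  le_on : ∀ x ∈ intervalUnion J u w, π ≤ x * ccdf P0 x
  le_off : ∀ x ∈ Icc (0 : ℝ) 1, x ∉ intervalUnion J u w → x * ccdf P0 x ≤ π

/-- The closed form of the mechanism. The cases cover every `v ∈ [0,1]`. -/
structure IsLogMechanism (k : ℝ) (J : ℕ) (u w : ℕ → ℝ) (q m : ℝ → ℝ) : Prop where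
  alloc_on : ∀ j ∈ Finset.Icc 1 J, ∀ v ∈ Ico (u j) (w j),
    q v = k * (∑ i ∈ Finset.Icc 1 (j - 1), Real.log (w i / u i) + Real.log (v / u j))
  pay_on : ∀ j ∈ Finset.Icc 1 J, ∀ v ∈ Ico (u j) (w j),
    m v = k * (∑ i ∈ Finset.Icc 1 (j - 1), (w i - u i) + (v - u j))
  alloc_between : ∀ j ≤ J, ∀ v ∈ Ico (w j) (u (j + 1)),
    q v = k * ∑ i ∈ Finset.Icc 1 j, Real.log (w i / u i)
  pay_between : ∀ j ≤ J, ∀ v ∈ Ico (w j) (u (j + 1)),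
    m v = k * ∑ i ∈ Finset.Icc 1 j, (w i - u i)
  alloc_one : q 1 = 1
  pay_one : m 1 = k * ∑ i ∈ Finset.Icc 1 J, (w i - u i)

/-- The law of the randomized price with density `(k / x) 1(x ∈ ⋃_j [u_j, w_j))`. -/
def priceLaw (k : ℝ) (J : ℕ) (u w : ℕ → ℝ) : Measure ℝ :=
  (volume.restrict (intervalUnion J u w)).withDensity fun x => ENNReal.ofReal (k / x)

/-- `(q, m)` is the randomized price mechanism of the price law `Q`:
`q(v) = 𝔼[1(v ≥ p̃)]` and `m(v) = 𝔼[p̃ 1(v ≥ p̃)]` for `p̃ ∼ Q`, a probability law on `[0,1]`. -/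
structure IsRandomizedPrice (Q : Measure ℝ) (q m : ℝ → ℝ) : Prop where
  law : IsValuationLaw Q
  alloc : ∀ v ∈ Icc (0 : ℝ) 1, q v = ∫ p, (Iic v).indicator (fun _ => (1 : ℝ)) p ∂Q
  pay : ∀ v ∈ Icc (0 : ℝ) 1, m v = ∫ p, (Iic v).indicator (fun p => p) p ∂Q

end RobustSatisficing

end

noncomputable section

namespace RobustSatisficing

/-! Lower bound. For `π > 0` let R be the law with tail min(P̄₀(x), π/x). No posted price earns more
than `π` against R, hence no mechanism does (`IsMechanism.integral_pay_le`), and R lies at distance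
d(π) from P₀. So every feasible k' satisfies τ ≤ π + k' d(π) (`IsFeasible.target_le_fragRevenue`).
At the minimizer π* this reads π* + k* d(π*) ≤ π* + k' d(π*) with d(π*) > 0, whence k* ≤ k'.

Attainment. Let U be the union of the intervals. A price with density k/x on U earns k ∫_U ℙ(ṽ ≥ x)
dx ≥ k ∫_U P̄ from a law P, and the right side falls by at most k per unit of distance. Its
normalization is the first-order condition at π*: the derivative of ρ(·, k) there is 1 - k ∫_U dx/x.
The same identity turns k ∫_U P̄₀ into π* + k d(π*) = τ, so the target is met at P₀. The closed form
follows by integrating 1/x and 1 over the intervals.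

Well-posedness. The curve x P̄₀(x) has no upward jumps, so it spends positive time in every band of
levels below Π₀; this makes d strictly midpoint convex on [0, Π₀] (`isoDist_midpoint_lt`) and the
minimizer unique. The slope k* is the maximum of (τ - π)/d(π) over [0, τ], and it is unique because
ρ* is strictly increasing while below Π₀. -/

lemma ccdf_nonneg (P : Measure ℝ) (x : ℝ) : 0 ≤ ccdf P x := measureReal_nonneg

lemma IsValuationLaw.ccdf_eq_zero {P : Measure ℝ} (hP : IsValuationLaw P) {x : ℝ} (hx : 1 ≤ x) :
    ccdf P x = 0 := by
  have hsub : Ioi x ⊆ (Icc (0 : ℝ) 1)ᶜ := fun y hy hy' => by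
    have := hy'.2
    have := mem_Ioi.1 hy
    linarith
  simp [ccdf, Measure.real, measure_mono_null hsub hP.supp]

lemma isoDist_eq (P : Measure ℝ) (π : ℝ) :
    isoDist P π = ∫ x in Ioc (0 : ℝ) 1, max (ccdf P x - π / x) 0 :=
  intervalIntegral.integral_of_le zero_le_one

lemma minFragRevenue_eq_of_isLeast {P : Measure ℝ} {k π : ℝ} (hπ : π ∈ Icc 0 (maxRevenue P))
    (h : ∀ π' ∈ Icc 0 (maxRevenue P), fragRevenue P π k ≤ fragRevenue P π' k) :
    minFragRevenue P k = fragRevenue P π k :=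
  IsLeast.csInf_eq ⟨⟨π, hπ, rfl⟩, by rintro _ ⟨π', hπ', rfl⟩; exact h π' hπ'⟩

/-! ### Tails and posted-price revenue -/

section ccdf

variable {P : Measure ℝ} [IsProbabilityMeasure P]

lemma ccdf_le_one (x : ℝ) : ccdf P x ≤ 1 := measureReal_le_one

lemma ccdf_antitone : Antitone (ccdf P) := fun _ _ h => measureReal_mono (Ioi_subset_Ioi h)

lemma ccdf_measurable : Measurable (ccdf P) := ccdf_antitone.measurable

lemma ccdf_le_real_Ici (x : ℝ) : ccdf P x ≤ P.real (Ici x) := measureReal_mono Ioi_subset_Ici_self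

lemma revenue_le_one {x : ℝ} (hx : x ∈ Icc (0 : ℝ) 1) : revenue P x ≤ 1 :=
  mul_le_one₀ hx.2 measureReal_nonneg measureReal_le_one

lemma bddAbove_revenue : BddAbove (revenue P '' Icc 0 1) :=
  ⟨1, by rintro _ ⟨x, hx, rfl⟩; exact revenue_le_one hx⟩

lemma mul_ccdf_le_maxRevenue {x : ℝ} (hx : x ∈ Icc (0 : ℝ) 1) : x * ccdf P x ≤ maxRevenue P :=
  (mul_le_mul_of_nonneg_left (ccdf_le_real_Ici x) hx.1).trans
    (le_csSup bddAbove_revenue ⟨x, hx, rfl⟩)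

/-- The curve `x ↦ x * ccdf P x` has no upward jumps. -/
lemma mul_div_le_mul_ccdf {x y : ℝ} (hy : 0 ≤ y) (hyx : y ≤ x) (hx : 0 < x) :
    x * ccdf P x * (y / x) ≤ y * ccdf P y := by
  have : x * ccdf P x * (y / x) = y * ccdf P x := by field_simp
  rw [this]
  exact mul_le_mul_of_nonneg_left (ccdf_antitone hyx) hy

/-- Π₀ is defined with closed tails. Lowering a good price r slightly to y costs little revenue, and
the open tail at y contains the closed tail at r. -/
lemma exists_lt_mul_ccdf {c : ℝ} (hc : 0 ≤ c) (h : c < maxRevenue P) :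
    ∃ x ∈ Ioo (0 : ℝ) 1, c < x * ccdf P x := by
  obtain ⟨_, ⟨r, hr, rfl⟩, hcr⟩ := exists_lt_of_lt_csSup
    ((nonempty_Icc.2 zero_le_one).image _) h
  rw [revenue] at hcr
  have hr0 : 0 < r := lt_of_le_of_ne hr.1 (by rintro rfl; simp at hcr; linarith)
  have hR : 0 < P.real (Ici r) := by
    by_contra! h0
    nlinarith
  obtain ⟨y, hy1, hy2⟩ := exists_between ((div_lt_iff₀ hR).2 hcr)
  have hy0 : 0 < y := lt_of_le_of_lt (by positivity) hy1
  refine ⟨y, ⟨hy0, hy2.trans_le hr.2⟩, ((div_lt_iff₀ hR).1 hy1).trans_le ?_⟩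
  exact mul_le_mul_of_nonneg_left (measureReal_mono fun z hz => hy2.trans_le hz) hy0.le

end ccdf

/-! ### The distance d(π): continuity, positivity, strict convexity -/

lemma exists_mem_Ioo_of_ae {p : ℝ → Prop}
    (h : ∀ᵐ x ∂volume.restrict (Ioc (0 : ℝ) 1), p x) {a b : ℝ} (ha : 0 ≤ a) (hab : a < b)
    (hb : b ≤ 1) : ∃ x ∈ Ioo a b, p x := by
  by_contra! hn
  rw [ae_restrict_iff' measurableSet_Ioc, ae_iff] at h
  have h0 : volume (Ioo a b) = 0 := measure_mono_null (fun x hx => by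
    simp only [mem_ofPred_eq, Classical.not_imp]
    exact ⟨⟨ha.trans_lt hx.1, hx.2.le.trans hb⟩, hn x hx⟩) h
  rw [Real.volume_Ioo, ENNReal.ofReal_eq_zero] at h0
  linarith

section isoDist

variable {P : Measure ℝ} [IsProbabilityMeasure P]

lemma measurable_isoGap (π : ℝ) : Measurable fun x => max (ccdf P x - π / x) 0 :=
  (ccdf_measurable.sub (by fun_prop)).max measurable_const

lemma isoGap_le_one {π x : ℝ} (hπ : 0 ≤ π) (hx : 0 ≤ x) : max (ccdf P x - π / x) 0 ≤ 1 :=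
  max_le (by have := ccdf_le_one (P := P) x; have : 0 ≤ π / x := by positivity
             linarith) zero_le_one

lemma integrable_isoGap {π : ℝ} (hπ : 0 ≤ π) :
    IntegrableOn (fun x => max (ccdf P x - π / x) 0) (Ioc 0 1) := by
  refine Measure.integrableOn_of_bounded (M := 1) (by simp) (measurable_isoGap π).aestronglyMeasurable ?_
  filter_upwards [ae_restrict_mem measurableSet_Ioc] with x hx
  rw [Real.norm_of_nonneg (le_max_right _ _)]
  exact isoGap_le_one hπ hx.1.le

lemma isoDist_nonneg (P : Measure ℝ) (π : ℝ) : 0 ≤ isoDist P π := by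
  rw [isoDist_eq]; exact integral_nonneg fun x => le_max_right _ _

lemma continuousOn_isoDist : ContinuousOn (isoDist P) (Ici 0) := by
  have : isoDist P = fun π => ∫ x in Ioc (0 : ℝ) 1, max (ccdf P x - π / x) 0 :=
    funext (isoDist_eq P)
  rw [this]
  refine continuousOn_of_dominated (bound := fun _ => 1)
    (fun π _ => (measurable_isoGap π).aestronglyMeasurable) (fun π hπ => ?_) (by simp)
    (ae_of_all _ fun x => by fun_prop)
  filter_upwards [ae_restrict_mem measurableSet_Ioc] with x hx
  rw [Real.norm_of_nonneg (le_max_right _ _)]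
  exact isoGap_le_one hπ hx.1.le

lemma isoDist_maxRevenue : isoDist P (maxRevenue P) = 0 := by
  rw [isoDist_eq]
  refine setIntegral_eq_zero_of_forall_eq_zero fun x hx => max_eq_right ?_
  rw [sub_nonpos, le_div_iff₀ hx.1, mul_comm]
  exact mul_ccdf_le_maxRevenue ⟨hx.1.le, hx.2⟩

/-- If x P̄(x) > π, then y P̄(y) > π for every y in the interval from π/P̄(x) to x, because P̄(y) ≥
P̄(x). The integrand is therefore positive on a set of positive measure. -/
lemma isoDist_pos {π : ℝ} (hπ : 0 ≤ π) (h : π < maxRevenue P) : 0 < isoDist P π := by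
  refine lt_of_le_of_ne (isoDist_nonneg P π) fun h0 => ?_
  rw [isoDist_eq, eq_comm] at h0
  replace h0 := (integral_eq_zero_iff_of_nonneg (fun x => le_max_right _ _)
    (integrable_isoGap hπ)).1 h0
  obtain ⟨x, hx, hlt⟩ := exists_lt_mul_ccdf hπ h
  have hc : π / (x * ccdf P x) < 1 := (div_lt_one (hπ.trans_lt hlt)).2 hlt
  have hxc : x * (π / (x * ccdf P x)) < x := by nlinarith [hx.1]
  obtain ⟨y, hy, hy0⟩ := exists_mem_Ioo_of_ae h0
    (mul_nonneg hx.1.le (div_nonneg hπ (hπ.trans hlt.le))) hxc hx.2.le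
  have hypos : 0 < y := lt_of_le_of_lt
    (mul_nonneg hx.1.le (div_nonneg hπ (hπ.trans hlt.le))) hy.1
  have h1 := mul_div_le_mul_ccdf (P := P) hypos.le hy.2.le hx.1
  have h2 : ccdf P y ≤ π / y := by
    have := (le_max_left (ccdf P y - π / y) 0).trans_eq hy0
    simpa using this
  rw [le_div_iff₀ hypos, mul_comm] at h2
  have h3 : π < x * ccdf P x * (y / x) := by
    have h4 := hy.1
    rw [mul_div_assoc', div_lt_iff₀ (hπ.trans_lt hlt)] at h4
    rw [mul_div_assoc', lt_div_iff₀ hx.1]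
    linarith
  linarith

/-- The curve `x ↦ x * ccdf P x` spends positive time in every interval of revenue levels. -/
lemma not_ae_mul_ccdf_notMem_Ioo {a b : ℝ} (ha : 0 ≤ a) (hab : a < b) (hb : b ≤ maxRevenue P) :
    ¬ ∀ᵐ x ∂volume.restrict (Ioc (0 : ℝ) 1), x * ccdf P x ≤ a ∨ b ≤ x * ccdf P x := by
  intro h
  obtain ⟨x, hx, hlt⟩ := exists_lt_mul_ccdf ha (hab.trans_le hb)
  -- After the last time s the curve is at most a before reaching x, it stays above a up to x;
  -- lacking upward jumps, it also stays below b for a while after s.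
  set A := {y ∈ Icc (0 : ℝ) x | y * ccdf P y ≤ a} with hA
  have hA0 : (0 : ℝ) ∈ A := ⟨⟨le_rfl, hx.1.le⟩, by simpa using ha⟩
  have hAb : BddAbove A := ⟨x, fun y hy => hy.1.2⟩
  set s := sSup A with hs
  have hsx : s ≤ x := csSup_le ⟨0, hA0⟩ fun y hy => hy.1.2
  have hs0 : 0 ≤ s := le_csSup hAb hA0
  -- near the supremum of a sublevel set, no value can be much above the level
  have key : ∀ c, a < c → ∃ d, s < d ∧ ∀ z, s ≤ z → z < d → 0 < z → z ≤ x → z * ccdf P z < c := by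
    intro c hc
    have hc0 : 0 < c := ha.trans_lt hc
    by_cases hsz : s = 0
    · refine ⟨c, by rw [hsz]; exact hc0, fun z hz hzd hz0 hzx => lt_of_le_of_lt ?_ hzd⟩
      exact mul_le_of_le_one_right hz0.le (ccdf_le_one z)
    · have hs1 : 0 < s := lt_of_le_of_ne hs0 (Ne.symm hsz)
      -- With a/c < t < r < 1 and y ∈ A beyond s r, every z < s r/t has y/z > t. A value at least c
      -- at z would then force one above c t > a at y.
      obtain ⟨t, ht1, ht2⟩ := exists_between ((div_lt_one hc0).2 hc)
      have ht0 : 0 < t := lt_of_le_of_lt (by positivity) ht1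
      rw [div_lt_iff₀ hc0] at ht1
      obtain ⟨r, hr1, hr2⟩ := exists_between ht2
      have hr0 : 0 < r := ht0.trans hr1
      obtain ⟨y, hyA, hy⟩ := exists_lt_of_lt_csSup ⟨0, hA0⟩ (show s * r < sSup A by
        rw [← hs]; exact mul_lt_of_lt_one_right hs1 hr2)
      refine ⟨s * (r / t), lt_mul_of_one_lt_right hs1 ((one_lt_div ht0).2 hr1),
        fun z hz hzd hz0 hzx => ?_⟩
      have h1 := mul_div_le_mul_ccdf (P := P) hyA.1.1 ((le_csSup hAb hyA).trans hz) hz0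
      have h2 : t < y / z := by
        rw [lt_div_iff₀ hz0]
        rw [mul_div_assoc', lt_div_iff₀ ht0] at hzd
        linarith
      by_contra! h3
      have h4 := hyA.2
      have : c * t < z * ccdf P z * (y / z) := by
        calc c * t < c * (y / z) := by gcongr
          _ ≤ _ := mul_le_mul_of_nonneg_right h3 (ht0.trans h2).le
      linarith
  have hsx' : s < x := by
    refine lt_of_le_of_ne hsx fun h0 => ?_
    obtain ⟨d, hd, hd'⟩ := key _ hlt
    exact lt_irrefl _ (hd' x h0.le (by linarith) hx.1 le_rfl)
  obtain ⟨d, hd, hd'⟩ := key b hab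
  obtain ⟨z, hz, hz'⟩ := exists_mem_Ioo_of_ae h hs0 (lt_min hd hsx')
    ((min_le_right _ _).trans hx.2.le)
  have hz0 : 0 < z := hs0.trans_lt hz.1
  have hzx : z ≤ x := (hz.2.trans_le (min_le_right _ _)).le
  rcases hz' with hz' | hz'
  · exact absurd (le_csSup hAb (show z ∈ A from ⟨⟨hz0.le, hzx⟩, hz'⟩)) (not_le.2 hz.1)
  · exact absurd (hd' z hz.1.le (hz.2.trans_le (min_le_left _ _)) hz0 hzx) (not_lt.2 hz')

/-- The integrand is convex in the level, and its midpoint gap `D` is positive wherever a < x P̄(x)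
< b. Equality would make that set null, against `not_ae_mul_ccdf_notMem_Ioo`. -/
lemma isoDist_midpoint_lt {a b : ℝ} (ha : 0 ≤ a) (hab : a < b) (hb : b ≤ maxRevenue P) :
    isoDist P ((a + b) / 2) < (isoDist P a + isoDist P b) / 2 := by
  have hb0 : 0 ≤ b := ha.trans hab.le
  have hm0 : 0 ≤ (a + b) / 2 := by positivity
  have ia := integrable_isoGap (P := P) ha
  have ib := integrable_isoGap (P := P) hb0
  have im := integrable_isoGap (P := P) hm0
  set D : ℝ → ℝ := fun x => (max (ccdf P x - a / x) 0 + max (ccdf P x - b / x) 0) / 2 -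
    max (ccdf P x - (a + b) / 2 / x) 0 with hD
  have hDi : IntegrableOn D (Ioc 0 1) := ((ia.add ib).div_const 2).sub im
  have hDint : ∫ x in Ioc (0 : ℝ) 1, D x = (isoDist P a + isoDist P b) / 2 -
      isoDist P ((a + b) / 2) := by
    simp only [isoDist_eq]
    rw [← integral_add ia ib, ← integral_div]
    exact integral_sub ((ia.add ib).div_const 2) im
  have hmid : ∀ x : ℝ, (a + b) / 2 / x = (a / x + b / x) / 2 := fun x => by ring
  have hD0 : 0 ≤ D := fun x => by
    simp only [hD, hmid, Pi.zero_apply]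
    grind
  have hpos := integral_nonneg (μ := volume.restrict (Ioc (0 : ℝ) 1)) hD0
  rw [hDint] at hpos
  refine lt_of_le_of_ne (by linarith) fun heq => ?_
  have h0 : ∫ x in Ioc (0 : ℝ) 1, D x = 0 := by rw [hDint]; linarith
  rw [integral_eq_zero_iff_of_nonneg hD0 hDi] at h0
  refine not_ae_mul_ccdf_notMem_Ioo ha hab hb ?_
  filter_upwards [h0, ae_restrict_mem measurableSet_Ioc] with x hx hx1
  simp only [hD, hmid, Pi.zero_apply] at hx
  rw [mul_comm, ← le_div_iff₀ hx1.1, ← div_le_iff₀ hx1.1]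
  by_contra! hc
  grind

end isoDist

/-! ### The value ρ*, its inverse, and the minimizer -/

section fragility

variable {P : Measure ℝ} [IsProbabilityMeasure P]

lemma exists_minFragRevenue_eq (hP : 0 ≤ maxRevenue P) (k : ℝ) :
    ∃ π ∈ Icc 0 (maxRevenue P), minFragRevenue P k = fragRevenue P π k ∧
      ∀ π' ∈ Icc 0 (maxRevenue P), fragRevenue P π k ≤ fragRevenue P π' k := by
  obtain ⟨π, hπ, h⟩ := isCompact_Icc.exists_isMinOn (nonempty_Icc.2 hP)
    (f := fun π => fragRevenue P π k) (continuousOn_id.add (continuousOn_const.mul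
      (continuousOn_isoDist.mono Icc_subset_Ici_self)))
  exact ⟨π, hπ, minFragRevenue_eq_of_isLeast hπ h, h⟩

lemma isoDist_pos_of_fragRevenue_lt {k π : ℝ} (hπ : π ∈ Icc 0 (maxRevenue P))
    (h : fragRevenue P π k < maxRevenue P) : 0 < isoDist P π := by
  refine isoDist_pos hπ.1 (lt_of_le_of_ne hπ.2 ?_)
  rintro rfl
  simp [fragRevenue, isoDist_maxRevenue] at h

/-- A minimizer for k' is not Π₀, where ρ equals Π₀, so it has d > 0; lowering the slope strictly
lowers ρ at that point. -/
lemma minFragRevenue_lt_of_lt {k k' : ℝ} (hP : 0 ≤ maxRevenue P) (hk : k < k')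
    (h : minFragRevenue P k' < maxRevenue P) : minFragRevenue P k < minFragRevenue P k' := by
  obtain ⟨π, hπ, h1, -⟩ := exists_minFragRevenue_eq hP k'
  obtain ⟨π₀, hπ₀, h3, h4⟩ := exists_minFragRevenue_eq hP k
  rw [h1] at h ⊢
  rw [h3]
  refine (h4 π hπ).trans_lt ?_
  have := isoDist_pos_of_fragRevenue_lt hπ h
  simp only [fragRevenue]
  gcongr

/-- The slope is the least k with τ ≤ π + k d(π) for all π ∈ [0, τ], namely the maximum of (τ -
π)/d(π). Equality holds at the maximizing π, and levels above τ satisfy the inequality trivially. No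
continuity of ρ* is needed. -/
lemma exists_pos_minFragRevenue_eq {τ : ℝ} (hτ : 0 < τ) (hτ' : τ < maxRevenue P) :
    ∃ k, 0 < k ∧ minFragRevenue P k = τ := by
  have hpos : ∀ π ∈ Icc 0 τ, 0 < isoDist P π := fun π hπ =>
    isoDist_pos hπ.1 (hπ.2.trans_lt hτ')
  obtain ⟨π, hπ, h⟩ := isCompact_Icc.exists_isMaxOn (nonempty_Icc.2 hτ.le)
    (f := fun π => (τ - π) / isoDist P π)
    ((continuousOn_const.sub continuousOn_id).div
      (continuousOn_isoDist.mono Icc_subset_Ici_self) fun π hπ => (hpos π hπ).ne')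
  refine ⟨(τ - π) / isoDist P π, ?_, ?_⟩
  · refine lt_of_lt_of_le ?_ (h (left_mem_Icc.2 hτ.le))
    exact div_pos (by linarith) (hpos 0 (left_mem_Icc.2 hτ.le))
  · have hval : fragRevenue P π ((τ - π) / isoDist P π) = τ := by
      have := hpos π hπ
      simp only [fragRevenue]
      field_simp
      ring
    rw [minFragRevenue_eq_of_isLeast ⟨hπ.1, hπ.2.trans hτ'.le⟩, hval]
    intro π' hπ'
    rw [hval]
    rcases le_total π' τ with h' | h'
    · have h1 : (τ - π') / isoDist P π' ≤ (τ - π) / isoDist P π := h ⟨hπ'.1, h'⟩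
      rw [div_le_iff₀ (hpos π' ⟨hπ'.1, h'⟩)] at h1
      simp only [fragRevenue]
      linarith
    · have : 0 ≤ (τ - π) / isoDist P π * isoDist P π' :=
        mul_nonneg (div_nonneg (by linarith [hπ.2]) (isoDist_nonneg _ _)) (isoDist_nonneg _ _)
      simp only [fragRevenue]
      linarith

lemma exists_isUniqueArgmin (hP : 0 ≤ maxRevenue P) {k : ℝ} (hk : 0 < k) :
    ∃ π, IsUniqueArgmin P k π := by
  obtain ⟨π, hπ, -, hmin⟩ := exists_minFragRevenue_eq hP k
  have mid : ∀ a b, 0 ≤ a → a < b → b ≤ maxRevenue P →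
      fragRevenue P π k < (fragRevenue P a k + fragRevenue P b k) / 2 := by
    intro a b ha hab hb
    refine (hmin ((a + b) / 2) ⟨by linarith, by linarith⟩).trans_lt ?_
    have := mul_lt_mul_of_pos_left (isoDist_midpoint_lt ha hab hb) hk
    simp only [fragRevenue]
    linarith
  refine ⟨π, hπ, fun π' hπ' hne => ?_⟩
  rcases lt_or_gt_of_ne hne with h | h
  · have := mid π' π hπ'.1 h hπ.2
    linarith
  · have := mid π π' hπ.1 h hπ'.2
    linarith

end fragility

/-! ### Incentive compatibility and the revenue bound -/

section mechanisms

variable {q m : ℝ → ℝ}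

lemma IsMechanism.alloc_mono (h : IsMechanism q m) : MonotoneOn q (Icc 0 1) := by
  intro v hv w hw hvw
  have h1 := h.ic v hv w hw
  have h2 := h.ic w hw v hv
  rcases hvw.eq_or_lt with rfl | hlt
  · rfl
  · by_contra! hc
    nlinarith

lemma IsMechanism.pay_mono (h : IsMechanism q m) : MonotoneOn m (Icc 0 1) := by
  intro v hv w hw hvw
  have h1 := h.ic v hv w hw
  have h2 := h.alloc_mono hv hw hvw
  nlinarith [hv.1]

lemma IsMechanism.pay_sub_le (h : IsMechanism q m) {v w : ℝ} (hv : v ∈ Icc (0 : ℝ) 1)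
    (hw : w ∈ Icc (0 : ℝ) 1) : m w - m v ≤ w * (q w - q v) := by
  have := h.ic w hw v hv
  linarith

/-- No mechanism beats posted prices: an upper bound on the revenue of all posted prices bounds the
revenue of every mechanism. -/
lemma IsMechanism.integral_pay_le (h : IsMechanism q m) {P : Measure ℝ} (hP : IsValuationLaw P)
    {π : ℝ} (hπ : ∀ x ∈ Icc (0 : ℝ) 1, x * ccdf P x ≤ π) : ∫ v, m v ∂P ≤ π := by
  have := hP.prob
  have hπ0 : 0 ≤ π := by simpa using hπ 0 (by simp)
  by_cases hm : Integrable m P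
  -- A payment rule that is not integrable has integral 0 by convention, and 0 ≤ π.
  swap
  · rwa [integral_undef hm]
  -- On the grid i/n the mechanism is dominated by a mixture of posted prices (i+1)/n with weights
  -- the increments of q. Sales are counted when v > i/n, which costs at most 1/n over the revenue
  -- at i/n.
  have hgrid : ∀ n : ℕ, 0 < n → ∫ v, m v ∂P ≤ π + 1 / n := by
    intro n hn
    have hn' : (0 : ℝ) < n := by exact_mod_cast hn
    have hmem : ∀ i ∈ Finset.range (n + 1), (i : ℝ) / n ∈ Icc (0 : ℝ) 1 := fun i hi => by
      have : (i : ℝ) ≤ n := by exact_mod_cast Nat.lt_succ_iff.1 (Finset.mem_range.1 hi)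
      exact ⟨by positivity, by rwa [div_le_one hn']⟩
    have hmem0 : ∀ i ∈ Finset.range n, (i : ℝ) / n ∈ Icc (0 : ℝ) 1 := fun i hi =>
      hmem i (by simp at hi ⊢; omega)
    have hmem1 : ∀ i ∈ Finset.range n, ((i + 1 : ℕ) : ℝ) / n ∈ Icc (0 : ℝ) 1 := fun i hi =>
      hmem (i + 1) (by simp at hi ⊢; omega)
    set d : ℕ → ℝ := fun i => q ((i + 1 : ℕ) / n) - q (i / n) with hd
    have hd0 : ∀ i ∈ Finset.range n, 0 ≤ d i := fun i hi =>
      sub_nonneg.2 (h.alloc_mono (hmem0 i hi) (hmem1 i hi) (by gcongr; simp))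
    have hpt : ∀ v ∈ Icc (0 : ℝ) 1, m v ≤ ∑ i ∈ Finset.range n,
        (Ioi ((i : ℝ) / n)).indicator (fun _ => ((i + 1 : ℕ) : ℝ) / n * d i) v := by
      intro v hv
      have hm0 : m 0 ≤ 0 := by simpa using h.ir 0 (by simp)
      -- The indices i < ⌈v n⌉ are exactly those with i/n < v, matching the open tails in `ccdf`.
      have hN : ⌈v * n⌉₊ ≤ n := Nat.ceil_le.2 (mul_le_of_le_one_left hn'.le hv.2)
      have hsub : Finset.range ⌈v * n⌉₊ ⊆ Finset.range n := Finset.range_subset_range.2 hN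
      have hvm : m v ≤ m (⌈v * n⌉₊ / n) := by
        refine h.pay_mono hv (hmem _ (Finset.mem_range.2 (by omega))) ?_
        rw [le_div_iff₀ hn']
        exact Nat.le_ceil _
      calc m v ≤ m (⌈v * n⌉₊ / n) - m ((0 : ℕ) / n) := by
            simp only [Nat.cast_zero, zero_div]; linarith
        _ = ∑ i ∈ Finset.range ⌈v * n⌉₊, (m ((i + 1 : ℕ) / n) - m (i / n)) :=
            (Finset.sum_range_sub (fun i : ℕ => m (i / n)) _).symm
        _ ≤ ∑ i ∈ Finset.range ⌈v * n⌉₊, ((i + 1 : ℕ) : ℝ) / n * d i :=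
            Finset.sum_le_sum fun i hi =>
              h.pay_sub_le (hmem0 i (hsub hi)) (hmem1 i (hsub hi))
        _ = ∑ i ∈ Finset.range ⌈v * n⌉₊,
            (Ioi ((i : ℝ) / n)).indicator (fun _ => ((i + 1 : ℕ) : ℝ) / n * d i) v := by
            refine Finset.sum_congr rfl fun i hi => ?_
            rw [indicator_of_mem]
            rw [mem_Ioi, div_lt_iff₀ hn']
            exact Nat.lt_ceil.1 (Finset.mem_range.1 hi)
        _ ≤ _ := Finset.sum_le_sum_of_subset_of_nonneg hsub fun i hi _ =>
            indicator_nonneg (fun _ _ => mul_nonneg (hmem1 i hi).1 (hd0 i hi)) _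
    have hae : ∀ᵐ v ∂P, v ∈ Icc (0 : ℝ) 1 := hP.supp
    have hint : ∀ i ∈ Finset.range n, Integrable
        ((Ioi ((i : ℝ) / n)).indicator (fun _ => ((i + 1 : ℕ) : ℝ) / n * d i)) P := fun i _ =>
      (integrable_const _).indicator measurableSet_Ioi
    calc ∫ v, m v ∂P ≤ ∫ v, ∑ i ∈ Finset.range n,
          (Ioi ((i : ℝ) / n)).indicator (fun _ => ((i + 1 : ℕ) : ℝ) / n * d i) v ∂P :=
          integral_mono_ae hm (integrable_finsetSum _ hint) (hae.mono hpt)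
      _ = ∑ i ∈ Finset.range n, ccdf P (i / n) * (((i + 1 : ℕ) : ℝ) / n * d i) := by
          rw [integral_finsetSum _ hint]
          refine Finset.sum_congr rfl fun i _ => ?_
          rw [integral_indicator measurableSet_Ioi, setIntegral_const, smul_eq_mul, ccdf]
      _ ≤ ∑ i ∈ Finset.range n, (π + 1 / n) * d i := by
          refine Finset.sum_le_sum fun i hi => ?_
          rw [← mul_assoc]
          refine mul_le_mul_of_nonneg_right ?_ (hd0 i hi)
          have h1 := hπ _ (hmem0 i hi)
          have h2 : ccdf P (i / n) * (1 / n) ≤ 1 / n :=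
            mul_le_of_le_one_left (by positivity) measureReal_le_one
          have h3 : ccdf P (i / n) * (((i + 1 : ℕ) : ℝ) / n) =
            i / n * ccdf P (i / n) + ccdf P (i / n) * (1 / n) := by push_cast; ring
          linarith
      _ = (π + 1 / n) * (q (n / n) - q ((0 : ℕ) / n)) := by
          rw [← Finset.mul_sum, Finset.sum_range_sub (fun i : ℕ => q (i / n))]
      _ ≤ π + 1 / n := by
          refine mul_le_of_le_one_right (by positivity) ?_
          have h1 := (h.alloc_mem _ (hmem n (by simp))).2
          have h2 := (h.alloc_mem _ (hmem 0 (by simp))).1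
          linarith
  have hlim := (tendsto_one_div_atTop_nhds_zero_nat (𝕜 := ℝ)).const_add π
  rw [add_zero] at hlim
  exact ge_of_tendsto hlim (Filter.eventually_atTop.2 ⟨1, fun n hn => hgrid n hn⟩)

end mechanisms

/-! ### Worst-case laws and the lower bound on fragility -/

/-- The distribution function of the isorevenue truncation, whose complementary distribution
function is the minimum of `ccdf P` and `π / x`. -/
def isoTruncation (P : Measure ℝ) {π : ℝ} (hπ : 0 < π) : StieltjesFunction ℝ where
  -- Replacing x by max x π makes the second term continuous on the line and zero for x ≤ π, where
  -- the tail bound π/x is vacuous.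
  toFun x := max (ProbabilityTheory.cdf P x) (1 - π / max x π)
  mono' x y h := by
    refine max_le_max (ProbabilityTheory.monotone_cdf P h) ?_
    have : 0 < max x π := lt_max_of_lt_right hπ
    gcongr
  right_continuous' x := by
    refine ((ProbabilityTheory.cdf P).right_continuous x).max (Continuous.continuousWithinAt ?_)
    exact continuous_const.sub (continuous_const.div (continuous_id.max continuous_const)
      fun y => (lt_max_of_lt_right hπ).ne')

lemma isoTruncation_apply (P : Measure ℝ) {π : ℝ} (hπ : 0 < π) (x : ℝ) :
    isoTruncation P hπ x = max (ProbabilityTheory.cdf P x) (1 - π / max x π) := rfl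

lemma cdf_eq_one_sub_ccdf (P : Measure ℝ) [IsProbabilityMeasure P] (x : ℝ) :
    ProbabilityTheory.cdf P x = 1 - ccdf P x := by
  rw [ProbabilityTheory.cdf_eq_real, ccdf, ← compl_Iic, probReal_compl_eq_one_sub measurableSet_Iic]
  ring

lemma exists_isValuationLaw_ccdf_eq_min {P : Measure ℝ} (hP : IsValuationLaw P) {π : ℝ}
    (hπ : 0 < π) : ∃ R, IsValuationLaw R ∧ ∀ x, 0 < x → ccdf R x = min (ccdf P x) (π / x) := by
  have := hP.prob
  have hpos : ∀ x : ℝ, x ∈ Iio 0 → isoTruncation P hπ x = 0 := by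
    intro x hx
    have hsub : Iic x ⊆ (Icc (0 : ℝ) 1)ᶜ := fun y hy hy' => by
      have := hy'.1
      have := mem_Iio.1 hx
      have := mem_Iic.1 hy
      linarith
    have h1 : P (Iic x) = 0 := measure_mono_null hsub hP.supp
    rw [isoTruncation_apply, ProbabilityTheory.cdf_eq_real, Measure.real, h1,
      max_eq_right (hx.le.trans hπ.le), div_self hπ.ne']
    simp
  have hone : ∀ x : ℝ, 1 ≤ x → isoTruncation P hπ x = 1 := by
    intro x hx
    have : 0 ≤ π / max x π := div_nonneg hπ.le (hπ.le.trans (le_max_right _ _))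
    rw [isoTruncation_apply, cdf_eq_one_sub_ccdf, hP.ccdf_eq_zero hx, sub_zero]
    exact max_eq_left (by linarith)
  have hbot : Filter.Tendsto (isoTruncation P hπ) Filter.atBot (nhds 0) :=
    tendsto_const_nhds.congr' (Filter.eventually_atBot.2
      ⟨-1, fun x hx => (hpos x (by simp; linarith)).symm⟩)
  have htop : Filter.Tendsto (isoTruncation P hπ) Filter.atTop (nhds 1) :=
    tendsto_const_nhds.congr' (Filter.eventually_atTop.2 ⟨1, fun x hx => (hone x hx).symm⟩)
  have hprob : IsProbabilityMeasure (isoTruncation P hπ).measure :=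
    (isoTruncation P hπ).isProbabilityMeasure hbot htop
  refine ⟨(isoTruncation P hπ).measure, ⟨hprob, ?_⟩, fun x hx => ?_⟩
  · have hc : (Icc (0 : ℝ) 1)ᶜ = Iio 0 ∪ Ioi 1 := by
      ext x
      simp only [mem_compl_iff, mem_Icc, mem_union, mem_Iio, mem_Ioi, not_and_or, not_le]
    rw [hc, measure_union_null_iff]
    constructor
    · rw [StieltjesFunction.measure_Iio _ hbot,
        leftLim_eq_of_tendsto (y := 0)]
      · simp
      · exact tendsto_const_nhds.congr' (Filter.eventually_of_mem self_mem_nhdsWithin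
          fun x hx => (hpos x hx).symm)
    · rw [StieltjesFunction.measure_Ioi _ htop, hone 1 le_rfl]
      simp
  · rw [ccdf, Measure.real, StieltjesFunction.measure_Ioi _ htop, isoTruncation_apply,
      cdf_eq_one_sub_ccdf]
    have h1 : ccdf P x ≤ 1 := measureReal_le_one
    have h2 : 0 ≤ ccdf P x := measureReal_nonneg
    have h3 : 1 - max (1 - ccdf P x) (1 - π / max x π) = min (ccdf P x) (π / max x π) := by
      rcases le_total (ccdf P x) (π / max x π) with h | h
      · rw [min_eq_left h, max_eq_left (by linarith)]; ring
      · rw [min_eq_right h, max_eq_right (by linarith)]; ring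
    rw [h3, ENNReal.toReal_ofReal (le_min h2 (by positivity))]
    rcases le_total π x with h | h
    · rw [max_eq_left h]
    · rw [max_eq_right h, div_self hπ.ne', min_eq_left h1, min_eq_left]
      exact h1.trans ((one_le_div hx).2 h)

lemma wdist_of_ccdf_eq_min {P R : Measure ℝ} {π : ℝ}
    (h : ∀ x, 0 < x → ccdf R x = min (ccdf P x) (π / x)) : wdist R P = isoDist P π := by
  rw [wdist, isoDist, intervalIntegral.integral_of_le zero_le_one,
    intervalIntegral.integral_of_le zero_le_one]
  refine setIntegral_congr_fun measurableSet_Ioc fun x hx => ?_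
  simp only [h x hx.1]
  rcases le_total (ccdf P x) (π / x) with h | h
  · rw [min_eq_left h, max_eq_right (by linarith)]; simp
  · rw [min_eq_right h, max_eq_left (by linarith), abs_of_nonpos (by linarith)]; ring

/-- The isorevenue truncation of the reference law bounds the fragility of every feasible point. -/
lemma IsFeasible.target_le_fragRevenue {P0 : Measure ℝ} (hP0 : IsValuationLaw P0) {τ k π : ℝ}
    {q m : ℝ → ℝ} (h : IsFeasible P0 τ q m k) (hπ : 0 < π) : τ ≤ fragRevenue P0 π k := by
  obtain ⟨R, hR, hmin⟩ := exists_isValuationLaw_ccdf_eq_min hP0 hπ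
  have h1 := h.satisficing R hR
  rw [wdist_of_ccdf_eq_min hmin] at h1
  have h2 := h.mech.integral_pay_le hR (π := π) fun x hx => by
    rcases hx.1.eq_or_lt with rfl | hx0
    · simpa using hπ.le
    · rw [hmin x hx0, mul_comm, ← le_div_iff₀ hx0]
      exact min_le_right _ _
  rw [fragRevenue]
  linarith

/-! ### First-order condition at the minimizer -/

section firstOrder

variable {P : Measure ℝ} [IsProbabilityMeasure P]

/-- Near zero the isorevenue distance decreases faster than linearly. -/
lemma argmin_fragRevenue_pos (hP : 0 < maxRevenue P) {k π : ℝ} (hk : 0 < k) (hπ : 0 ≤ π)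
    (hmin : ∀ π' ∈ Icc 0 (maxRevenue P), fragRevenue P π k ≤ fragRevenue P π' k) : 0 < π := by
  refine lt_of_le_of_ne hπ ?_
  rintro rfl
  obtain ⟨a, ha, hga⟩ := exists_lt_mul_ccdf le_rfl hP
  have hg : 0 < ccdf P a := pos_of_mul_pos_right hga ha.1.le
  -- Chosen so that log(a/b) = 2/k: raising the level from 0 to ε lowers k d by at least 2ε, more
  -- than the cost ε. The level ε = P̄(a) b keeps ε/x ≤ P̄(x) on (b, a].
  set b := a * Real.exp (-(2 / k)) with hb
  have hb0 : 0 < b := mul_pos ha.1 (Real.exp_pos _)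
  have hba : b < a := mul_lt_of_lt_one_right ha.1 (Real.exp_lt_one_iff.2 (by
    have : 0 < 2 / k := by positivity
    linarith))
  set ε := ccdf P a * b with hε
  have hε0 : 0 < ε := mul_pos hg hb0
  have hεP : ε ≤ maxRevenue P := by
    refine le_trans ?_ (mul_ccdf_le_maxRevenue (P := P) ⟨ha.1.le, ha.2.le⟩)
    rw [hε, mul_comm a]
    exact mul_le_mul_of_nonneg_left hba.le hg.le
  have hlog : ∫ x in Ioc b a, ε * (1 / x) = ε * (2 / k) := by
    rw [integral_const_mul, ← intervalIntegral.integral_of_le hba.le,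
      integral_one_div_of_pos hb0 ha.1, hb, Real.log_div ha.1.ne' hb0.ne',
      Real.log_mul ha.1.ne' (Real.exp_pos _).ne', Real.log_exp]
    ring
  have i0 := integrable_isoGap (P := P) le_rfl
  have i1 := integrable_isoGap (P := P) hε0.le
  have hle : ∫ x in Ioc b a, ε * (1 / x) ≤ isoDist P 0 - isoDist P ε := by
    rw [isoDist_eq, isoDist_eq, ← integral_sub i0 i1]
    calc ∫ x in Ioc b a, ε * (1 / x)
        = ∫ x in Ioc b a, (max (ccdf P x - 0 / x) 0 - max (ccdf P x - ε / x) 0) := by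
          refine setIntegral_congr_fun measurableSet_Ioc fun x hx => ?_
          have hx0 : 0 < x := hb0.trans hx.1
          have h1 : ε / x ≤ ccdf P x := by
            rw [div_le_iff₀ hx0]
            calc ε ≤ ccdf P a * x := mul_le_mul_of_nonneg_left hx.1.le hg.le
              _ ≤ _ := mul_le_mul_of_nonneg_right (ccdf_antitone hx.2) hx0.le
          have h2 : 0 ≤ ccdf P x := ccdf_nonneg P x
          simp only [zero_div, sub_zero]
          rw [max_eq_left h2, max_eq_left (by linarith)]
          ring
      _ ≤ _ := by
          refine setIntegral_mono_set (i0.sub i1) ?_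
            (Ioc_subset_Ioc hb0.le ha.2.le).eventuallyLE
          filter_upwards [ae_restrict_mem measurableSet_Ioc] with x hx
          have : 0 ≤ ε / x := div_nonneg hε0.le hx.1.le
          rw [Pi.zero_apply, sub_nonneg, zero_div]
          exact max_le_max (by linarith) le_rfl
  have h := hmin ε ⟨hε0.le, hεP⟩
  rw [hlog] at hle
  have hk2 : k * (ε * (2 / k)) = 2 * ε := by field_simp
  have := mul_le_mul_of_nonneg_left hle hk.le
  simp only [fragRevenue] at h
  linarith

/-- Differentiation under the integral: the positive part has a kink only where P̄(x) = π/x, a null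
set by hypothesis. -/
lemma hasDerivAt_isoDist {π : ℝ} (hπ : 0 < π)
    (hnull : volume {x ∈ Ioc (0 : ℝ) 1 | ccdf P x = π / x} = 0) :
    HasDerivAt (isoDist P)
      (-∫ x in Ioc (0 : ℝ) 1, {x | π / x < ccdf P x}.indicator (fun x => 1 / x) x) π := by
  have hmeas : MeasurableSet {x | π / x < ccdf P x} :=
    measurableSet_lt (by fun_prop) ccdf_measurable
  have heq : isoDist P = fun π => ∫ x in Ioc (0 : ℝ) 1, max (ccdf P x - π / x) 0 :=
    funext (isoDist_eq P)
  rw [heq, ← integral_neg]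
  -- For levels above π/2 the integrand vanishes when x < π/2, and otherwise its Lipschitz constant
  -- 1/x is at most 2/π; this removes the singularity at 0.
  refine (hasDerivAt_integral_of_dominated_loc_of_lip (s := Ioi (π / 2))
    (bound := fun _ => 2 / π) (Ioi_mem_nhds (by linarith))
    (Filter.Eventually.of_forall fun y => (measurable_isoGap y).aestronglyMeasurable)
    (integrable_isoGap hπ.le) ?_ ?_ (by simp) ?_).2
  · exact (((measurable_const.div measurable_id).indicator hmeas).neg).aestronglyMeasurable
  · filter_upwards [ae_restrict_mem measurableSet_Ioc] with x hx
    refine LipschitzOnWith.of_dist_le_mul fun y hy z hz => ?_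
    have hC : (0 : ℝ) ≤ 2 / π := by positivity
    rw [Real.coe_nnabs, abs_of_nonneg hC]
    rcases lt_or_ge x (π / 2) with h | h
    · have hzero : ∀ y ∈ Ioi (π / 2), max (ccdf P x - y / x) 0 = 0 := fun y hy => by
        refine max_eq_right ?_
        have h1 := ccdf_le_one (P := P) x
        have h2 : 1 ≤ y / x := (one_le_div hx.1).2 (h.le.trans (mem_Ioi.1 hy).le)
        linarith
      rw [hzero y hy, hzero z hz, dist_self]
      positivity
    · rw [Real.dist_eq, Real.dist_eq]
      refine (abs_max_sub_max_le_abs _ _ _).trans ?_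
      have h1 : ccdf P x - y / x - (ccdf P x - z / x) = -(1 / x * (y - z)) := by ring
      have h2 : 1 / x ≤ 2 / π := by
        rw [div_le_div_iff₀ hx.1 hπ]
        linarith
      rw [h1, abs_neg, abs_mul, abs_of_pos (one_div_pos.2 hx.1)]
      exact mul_le_mul_of_nonneg_right h2 (abs_nonneg _)
  · have hne : ∀ᵐ x, ¬(x ∈ Ioc (0 : ℝ) 1 ∧ ccdf P x = π / x) := measure_eq_zero_iff_ae_notMem.1 hnull
    filter_upwards [ae_restrict_of_ae hne, ae_restrict_mem measurableSet_Ioc] with x hx hx1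
    have hdiv : Continuous fun y : ℝ => y / x := by fun_prop
    rcases lt_or_gt_of_ne (fun h => hx ⟨hx1, h⟩) with h | h
    · rw [indicator_of_notMem (by simpa using h.le), neg_zero]
      refine (hasDerivAt_const π (0 : ℝ)).congr_of_eventuallyEq ?_
      filter_upwards [hdiv.continuousAt.eventually_const_lt h] with y hy
      exact max_eq_right (by linarith)
    · rw [indicator_of_mem (by simpa using h)]
      have hd : HasDerivAt (fun y : ℝ => ccdf P x - y / x) (-(1 / x)) π := by
        simpa using ((hasDerivAt_id π).div_const x).const_sub (ccdf P x)
      refine hd.congr_of_eventuallyEq ?_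
      filter_upwards [hdiv.continuousAt.eventually_lt_const h] with y hy
      exact max_eq_left (by linarith)

lemma first_order_condition {k π : ℝ} (hπ : 0 < π) (hπ' : π < maxRevenue P)
    (hmin : ∀ π' ∈ Icc 0 (maxRevenue P), fragRevenue P π k ≤ fragRevenue P π' k)
    (hnull : volume {x ∈ Ioc (0 : ℝ) 1 | ccdf P x = π / x} = 0) :
    k * ∫ x in Ioc (0 : ℝ) 1, {x | π / x < ccdf P x}.indicator (fun x => 1 / x) x = 1 := by
  have hd : HasDerivAt (fun π => fragRevenue P π k) _ π :=
    (hasDerivAt_id π).add ((hasDerivAt_isoDist hπ hnull).const_mul k)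
  have hloc : IsLocalMin (fun π => fragRevenue P π k) π :=
    Filter.eventually_of_mem (Icc_mem_nhds hπ hπ') hmin
  have := hloc.hasDerivAt_eq_zero hd
  linarith

end firstOrder

/-! ### Randomized posted prices as mechanisms -/

section randomizedPrice

/-- The allocation probabilities of the randomized posted price with law `Q`. -/
def priceAlloc (Q : Measure ℝ) (v : ℝ) : ℝ := ∫ p, (Iic v).indicator (fun _ => (1 : ℝ)) p ∂Q

/-- The expected payments of the randomized posted price with law `Q`. -/
def pricePay (Q : Measure ℝ) (v : ℝ) : ℝ := ∫ p, (Iic v).indicator (fun p => p) p ∂Q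

variable {Q : Measure ℝ}

lemma IsValuationLaw.integrable_indicator_id (hQ : IsValuationLaw Q) (v : ℝ) :
    Integrable ((Iic v).indicator fun p => p) Q := by
  have := hQ.prob
  have hae : ∀ᵐ p ∂Q, p ∈ Icc (0 : ℝ) 1 := hQ.supp
  have : Integrable (fun p : ℝ => p) Q := by
    refine Integrable.of_bound (C := 1) (by fun_prop) (hae.mono fun p hp => ?_)
    rw [Real.norm_of_nonneg hp.1]
    exact hp.2
  exact this.indicator measurableSet_Iic

lemma IsValuationLaw.priceAlloc_mul_sub_pricePay (hQ : IsValuationLaw Q) (v ω : ℝ) :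
    priceAlloc Q ω * v - pricePay Q ω = ∫ p, (Iic ω).indicator (fun p => v - p) p ∂Q := by
  have := hQ.prob
  rw [priceAlloc, pricePay, ← integral_mul_const, ← integral_sub
    (((integrable_const _).indicator measurableSet_Iic).mul_const v)
    (hQ.integrable_indicator_id ω)]
  congr 1 with p
  by_cases hp : p ∈ Iic ω <;> simp [hp]

/-- Reporting ω means buying at the prices p ≤ ω, for a surplus of v - p each; truth-telling
collects precisely the nonnegative ones. -/
lemma IsValuationLaw.isMechanism_price (hQ : IsValuationLaw Q) :
    IsMechanism (priceAlloc Q) (pricePay Q) := by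
  have := hQ.prob
  have hi : ∀ v ω : ℝ, Integrable ((Iic ω).indicator fun p => v - p) Q := fun v ω => by
    have := ((integrable_const (v : ℝ)).indicator (measurableSet_Iic (a := ω))).sub
      (hQ.integrable_indicator_id ω)
    refine this.congr (ae_of_all _ fun p => ?_)
    by_cases hp : p ∈ Iic ω <;> simp [hp]
  refine ⟨fun v hv => ?_, fun v hv => ?_, fun v hv ω hω => ?_⟩
  · rw [priceAlloc, integral_indicator_const _ measurableSet_Iic, smul_eq_mul, mul_one]
    exact ⟨measureReal_nonneg, measureReal_le_one⟩
  · rw [hQ.priceAlloc_mul_sub_pricePay]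
    refine integral_nonneg fun p => indicator_nonneg (fun p hp => ?_) p
    exact sub_nonneg.2 hp
  · rw [hQ.priceAlloc_mul_sub_pricePay, hQ.priceAlloc_mul_sub_pricePay]
    refine integral_mono (hi v ω) (hi v v) fun p => ?_
    by_cases h1 : p ≤ ω <;> by_cases h2 : p ≤ v <;> simp [indicator, h1, h2]
    all_goals linarith

/-- Fubini on {p ≤ v}: the revenue is the average of posted-price revenues. -/
lemma IsValuationLaw.integral_pricePay (hQ : IsValuationLaw Q) {P : Measure ℝ}
    [IsProbabilityMeasure P] : ∫ v, pricePay Q v ∂P = ∫ p, p * P.real (Ici p) ∂Q := by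
  have := hQ.prob
  have hae : ∀ᵐ p ∂Q, p ∈ Icc (0 : ℝ) 1 := hQ.supp
  have hmeas : Measurable (Function.uncurry fun v p : ℝ => (Iic v).indicator (fun p => p) p) := by
    have : (Function.uncurry fun v p : ℝ => (Iic v).indicator (fun p => p) p) =
        {z : ℝ × ℝ | z.2 ≤ z.1}.indicator Prod.snd := by
      ext z
      simp [Function.uncurry, indicator]
    rw [this]
    exact measurable_snd.indicator (measurableSet_le measurable_snd measurable_fst)
  have hint : Integrable (Function.uncurry fun v p : ℝ => (Iic v).indicator (fun p => p) p)
      (P.prod Q) := by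
    refine Integrable.of_bound (C := 1) hmeas.aestronglyMeasurable ?_
    have h2 : ∀ᵐ z ∂P.prod Q, z.2 ∈ Icc (0 : ℝ) 1 := Measure.quasiMeasurePreserving_snd.ae hae
    filter_upwards [h2] with z hz
    by_cases h : z.2 ≤ z.1 <;> simp [Function.uncurry, indicator, h]
    exact abs_le.2 ⟨by linarith [hz.1], hz.2⟩
  simp only [pricePay]
  rw [integral_integral_swap hint]
  congr 1 with p
  have : (fun v : ℝ => (Iic v).indicator (fun p => p) p) = (Ici p).indicator fun _ => p := by
    ext v
    simp [indicator]
  rw [this, integral_indicator_const _ measurableSet_Ici, smul_eq_mul, mul_comm]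

end randomizedPrice

/-! ### The price density on the intervals and its closed form -/

lemma measurableSet_intervalUnion (J : ℕ) (u w : ℕ → ℝ) :
    MeasurableSet (intervalUnion J u w) :=
  Finset.measurableSet_biUnion _ fun _ _ => measurableSet_Ico

lemma mem_intervalUnion {J : ℕ} {u w : ℕ → ℝ} {x : ℝ} :
    x ∈ intervalUnion J u w ↔ ∃ j ∈ Finset.Icc 1 J, x ∈ Ico (u j) (w j) := by
  simp only [intervalUnion, mem_iUnion, exists_prop]

namespace IsIsoRevenueIntervals

variable {P0 : Measure ℝ} {π : ℝ} {J : ℕ} {u w : ℕ → ℝ}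

lemma w_le_u_of_lt (h : IsIsoRevenueIntervals P0 π J u w) {i j : ℕ} (hij : i < j)
    (hj : j ≤ J + 1) : w i ≤ u j := by
  induction j, hij using Nat.le_induction with
  | base => exact h.w_le_u i (by omega)
  | succ n hn ih =>
    have h1 := h.u_lt_w n (Finset.mem_Icc.2 ⟨by omega, by omega⟩)
    exact (ih (by omega)).trans (h1.le.trans (h.w_le_u n (by omega)))

lemma w_le_w (h : IsIsoRevenueIntervals P0 π J u w) {i j : ℕ} (hij : i ≤ j) (hj : j ≤ J) :
    w i ≤ w j := by
  rcases hij.eq_or_lt with rfl | hlt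
  · rfl
  · exact (h.w_le_u_of_lt hlt (by omega)).trans (h.u_lt_w j (Finset.mem_Icc.2 ⟨by omega, hj⟩)).le

lemma w_le_one (h : IsIsoRevenueIntervals P0 π J u w) {j : ℕ} (hj : j ≤ J) : w j ≤ 1 :=
  (h.w_le_u_of_lt (Nat.lt_succ_of_le hj) le_rfl).trans_eq h.u_last

lemma pairwise_disjoint (h : IsIsoRevenueIntervals P0 π J u w) :
    Set.Pairwise (Finset.Icc 1 J : Set ℕ) (Function.onFun Disjoint fun j => Ico (u j) (w j)) := by
  have key : ∀ i j, i < j → j ≤ J → Disjoint (Ico (u i) (w i)) (Ico (u j) (w j)) :=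
    fun i j hij hj => Set.disjoint_left.2 fun x hx hx' =>
      absurd (hx.2.trans_le (h.w_le_u_of_lt hij (by omega))) (not_lt.2 hx'.1)
  intro i hi j hj hne
  simp only [Finset.coe_Icc, mem_Icc] at hi hj
  rcases lt_or_gt_of_ne hne with hlt | hlt
  · exact key i j hlt hj.2
  · exact (key j i hlt hi.2).symm

/-- From x P̄₀(x) ≥ π > 0: P̄₀ ≤ 1 forces x ≥ π, and P̄₀ = 0 on [1, ∞) forces x < 1. Staying away
from 0 makes 1/x bounded on the union. -/
lemma intervalUnion_subset (h : IsIsoRevenueIntervals P0 π J u w) (hP0 : IsValuationLaw P0)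
    (hπ : 0 < π) : intervalUnion J u w ⊆ Ico π 1 := by
  have := hP0.prob
  intro x hx
  have h1 := h.le_on x hx
  have h2 := ccdf_nonneg P0 x
  have h3 := ccdf_le_one (P := P0) x
  have hx0 : 0 < x := by
    by_contra! hc
    nlinarith
  refine ⟨by nlinarith, ?_⟩
  by_contra! hc
  rw [hP0.ccdf_eq_zero hc] at h1
  linarith

lemma u_pos (h : IsIsoRevenueIntervals P0 π J u w) (hP0 : IsValuationLaw P0) (hπ : 0 < π) {j : ℕ}
    (hj : j ∈ Finset.Icc 1 J) : 0 < u j :=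
  hπ.trans_le (h.intervalUnion_subset hP0 hπ
    (mem_intervalUnion.2 ⟨j, hj, left_mem_Ico.2 (h.u_lt_w j hj)⟩)).1

lemma ae_mem_iff (h : IsIsoRevenueIntervals P0 π J u w)
    (hnull : volume {x ∈ Ioc (0 : ℝ) 1 | ccdf P0 x = π / x} = 0) :
    ∀ᵐ x ∂volume.restrict (Ioc (0 : ℝ) 1), x ∈ intervalUnion J u w ↔ π / x < ccdf P0 x := by
  have hne : ∀ᵐ x, ¬(x ∈ Ioc (0 : ℝ) 1 ∧ ccdf P0 x = π / x) :=
    measure_eq_zero_iff_ae_notMem.1 hnull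
  filter_upwards [ae_restrict_of_ae hne, ae_restrict_mem measurableSet_Ioc] with x hx hx1
  constructor
  · intro hU
    refine lt_of_le_of_ne ?_ fun h => hx ⟨hx1, h.symm⟩
    rw [div_le_iff₀ hx1.1, mul_comm]
    exact h.le_on x hU
  · intro hlt
    by_contra hU
    have := h.le_off x ⟨hx1.1.le, hx1.2⟩ hU
    rw [div_lt_iff₀ hx1.1] at hlt
    linarith

lemma integral_inv_eq (h : IsIsoRevenueIntervals P0 π J u w) (hP0 : IsValuationLaw P0)
    (hπ : 0 < π) (hnull : volume {x ∈ Ioc (0 : ℝ) 1 | ccdf P0 x = π / x} = 0) :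
    ∫ x in Ioc (0 : ℝ) 1, {x | π / x < ccdf P0 x}.indicator (fun x => 1 / x) x =
      ∫ x in intervalUnion J u w, 1 / x := by
  have hU : intervalUnion J u w ⊆ Ioc (0 : ℝ) 1 := fun x hx =>
    have := h.intervalUnion_subset hP0 hπ hx
    ⟨hπ.trans_le this.1, this.2.le⟩
  calc _ = ∫ x in Ioc (0 : ℝ) 1, (intervalUnion J u w).indicator (fun x => 1 / x) x := by
        refine integral_congr_ae ?_
        filter_upwards [h.ae_mem_iff hnull] with x hx
        by_cases hx' : x ∈ intervalUnion J u w
        · rw [indicator_of_mem hx', indicator_of_mem (show x ∈ {x | π / x < ccdf P0 x} from hx.1 hx')]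
        · rw [indicator_of_notMem hx', indicator_of_notMem
            (show x ∉ {x | π / x < ccdf P0 x} from fun hc => hx' (hx.2 hc))]
    _ = _ := by
        rw [setIntegral_indicator (measurableSet_intervalUnion J u w), inter_eq_right.2 hU]

lemma isoDist_eq_setIntegral (h : IsIsoRevenueIntervals P0 π J u w) (hP0 : IsValuationLaw P0)
    (hπ : 0 < π) : isoDist P0 π = ∫ x in intervalUnion J u w, (ccdf P0 x - π / x) := by
  have hU : intervalUnion J u w ⊆ Ioc (0 : ℝ) 1 := fun x hx =>
    have := h.intervalUnion_subset hP0 hπ hx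
    ⟨hπ.trans_le this.1, this.2.le⟩
  rw [isoDist_eq, ← inter_eq_right.2 hU,
    ← setIntegral_indicator (measurableSet_intervalUnion J u w)]
  refine setIntegral_congr_fun measurableSet_Ioc fun x hx => ?_
  by_cases hx' : x ∈ intervalUnion J u w
  · rw [indicator_of_mem hx']
    refine max_eq_left (sub_nonneg.2 ?_)
    rw [div_le_iff₀ hx.1, mul_comm]
    exact h.le_on x hx'
  · rw [indicator_of_notMem hx']
    refine max_eq_right (sub_nonpos.2 ?_)
    rw [le_div_iff₀ hx.1, mul_comm]
    exact h.le_off x ⟨hx.1.le, hx.2⟩ hx'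

lemma integrableOn_of_abs_le (h : IsIsoRevenueIntervals P0 π J u w) (hP0 : IsValuationLaw P0)
    (hπ : 0 < π) {g : ℝ → ℝ} (hg : Measurable g) {C : ℝ} (hC : ∀ x, π ≤ x → |g x| ≤ C) :
    IntegrableOn g (intervalUnion J u w) := by
  have hU := h.intervalUnion_subset hP0 hπ
  refine Measure.integrableOn_of_bounded (M := C) ?_ hg.aestronglyMeasurable ?_
  · refine ne_top_of_le_ne_top ?_ (measure_mono hU)
    simp
  · filter_upwards [ae_restrict_mem (measurableSet_intervalUnion J u w)] with x hx
    exact hC x (hU hx).1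

lemma integrableOn_inv (h : IsIsoRevenueIntervals P0 π J u w) (hP0 : IsValuationLaw P0)
    (hπ : 0 < π) : IntegrableOn (fun x => 1 / x) (intervalUnion J u w) := by
  refine h.integrableOn_of_abs_le hP0 hπ (by fun_prop) (C := 1 / π) fun x hx => ?_
  rw [abs_of_pos (one_div_pos.2 (hπ.trans_le hx))]
  exact one_div_le_one_div_of_le hπ hx

lemma integrableOn_ccdf (h : IsIsoRevenueIntervals P0 π J u w) (hP0 : IsValuationLaw P0)
    (hπ : 0 < π) (P : Measure ℝ) [IsProbabilityMeasure P] :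
    IntegrableOn (ccdf P) (intervalUnion J u w) := by
  refine h.integrableOn_of_abs_le hP0 hπ ccdf_measurable (C := 1) fun x _ => ?_
  rw [abs_of_nonneg (ccdf_nonneg P x)]
  exact ccdf_le_one x

lemma integral_priceLaw (h : IsIsoRevenueIntervals P0 π J u w) (hP0 : IsValuationLaw P0)
    (hπ : 0 < π) {k : ℝ} (hk : 0 < k) (g : ℝ → ℝ) :
    ∫ p, g p ∂priceLaw k J u w = ∫ x in intervalUnion J u w, k / x * g x := by
  rw [priceLaw, integral_withDensity_eq_integral_toReal_smul (by fun_prop) (by simp)]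
  refine setIntegral_congr_fun (measurableSet_intervalUnion J u w) fun x hx => ?_
  have hx0 : 0 < x := hπ.trans_le (h.intervalUnion_subset hP0 hπ hx).1
  simp only [smul_eq_mul]
  rw [ENNReal.toReal_ofReal (by positivity)]

lemma isValuationLaw_priceLaw (h : IsIsoRevenueIntervals P0 π J u w) (hP0 : IsValuationLaw P0)
    (hπ : 0 < π) {k : ℝ} (hk : 0 < k) (hone : k * ∫ x in intervalUnion J u w, 1 / x = 1) :
    IsValuationLaw (priceLaw k J u w) := by
  have hU := h.intervalUnion_subset hP0 hπ
  refine ⟨⟨?_⟩, ?_⟩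
  · have hi : IntegrableOn (fun x => k / x) (intervalUnion J u w) := by
      have := (h.integrableOn_inv hP0 hπ).const_mul k
      simp only [mul_one_div] at this
      exact this
    rw [priceLaw, withDensity_apply _ MeasurableSet.univ, Measure.restrict_univ,
      ← ofReal_integral_eq_lintegral_ofReal hi]
    · rw [← integral_const_mul] at hone
      simp only [mul_one_div] at hone
      rw [hone, ENNReal.ofReal_one]
    · filter_upwards [ae_restrict_mem (measurableSet_intervalUnion J u w)] with x hx
      exact div_nonneg hk.le (hπ.le.trans (hU hx).1)
  · refine withDensity_absolutelyContinuous _ _ ?_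
    rw [Measure.restrict_apply measurableSet_Icc.compl]
    convert measure_empty (μ := (volume : Measure ℝ))
    ext x
    simp only [mem_inter_iff, mem_compl_iff, mem_empty_iff_false, iff_false, not_and]
    intro hx hxU
    exact hx ⟨hπ.le.trans (hU hxU).1, (hU hxU).2.le⟩

lemma integral_indicator_Iic (h : IsIsoRevenueIntervals P0 π J u w) {g : ℝ → ℝ} (v : ℝ)
    (hg : IntegrableOn g (intervalUnion J u w)) :
    ∫ x in intervalUnion J u w, (Iic v).indicator g x =
      ∑ i ∈ Finset.Icc 1 J, ∫ x in Ioc (u i) (min (w i) v), g x := by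
  have hg' : ∀ i ∈ Finset.Icc 1 J, IntegrableOn ((Iic v).indicator g) (Ico (u i) (w i)) :=
    fun i hi => (hg.mono_set fun x hx => mem_intervalUnion.2 ⟨i, hi, hx⟩).indicator
      measurableSet_Iic
  rw [intervalUnion, integral_biUnion_finset _ (fun _ _ => measurableSet_Ico)
    h.pairwise_disjoint hg']
  refine Finset.sum_congr rfl fun i _ => ?_
  rw [setIntegral_congr_set (Ico_ae_eq_Ioc (μ := volume)), setIntegral_indicator measurableSet_Iic,
    Ioc_inter_Iic]

lemma sum_integral_on (h : IsIsoRevenueIntervals P0 π J u w) (g : ℝ → ℝ) {j : ℕ}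
    (hj : j ∈ Finset.Icc 1 J) {v : ℝ} (hv : v ∈ Ico (u j) (w j)) :
    ∑ i ∈ Finset.Icc 1 J, ∫ x in Ioc (u i) (min (w i) v), g x =
      ∑ i ∈ Finset.Icc 1 (j - 1), (∫ x in u i..w i, g x) + ∫ x in u j..v, g x := by
  obtain ⟨hj1, hjJ⟩ := Finset.mem_Icc.1 hj
  have hsub : Finset.Icc 1 j ⊆ Finset.Icc 1 J := Finset.Icc_subset_Icc_right hjJ
  rw [← Finset.sum_subset hsub]
  · obtain ⟨n, rfl⟩ : ∃ n, j = n + 1 := ⟨j - 1, by omega⟩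
    rw [Finset.sum_Icc_succ_top (by omega), min_eq_right hv.2.le,
      intervalIntegral.integral_of_le hv.1, Nat.add_sub_cancel]
    congr 1
    refine Finset.sum_congr rfl fun i hi => ?_
    obtain ⟨hi1, hin⟩ := Finset.mem_Icc.1 hi
    have h1 := h.w_le_u_of_lt (show i < n + 1 by omega) (by omega)
    rw [min_eq_left (h1.trans hv.1), intervalIntegral.integral_of_le
      (h.u_lt_w i (Finset.mem_Icc.2 ⟨hi1, by omega⟩)).le]
  · intro i hi hi'
    simp only [Finset.mem_Icc] at hi hi'
    have h1 := h.w_le_u_of_lt (show j < i by omega) (by omega)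
    rw [Ioc_eq_empty, setIntegral_empty]
    exact not_lt.2 ((min_le_right _ _).trans (hv.2.le.trans h1))

lemma sum_integral_between (h : IsIsoRevenueIntervals P0 π J u w) (g : ℝ → ℝ) {j : ℕ}
    (hj : j ≤ J) {v : ℝ} (hv : v ∈ Icc (w j) (u (j + 1))) :
    ∑ i ∈ Finset.Icc 1 J, ∫ x in Ioc (u i) (min (w i) v), g x =
      ∑ i ∈ Finset.Icc 1 j, ∫ x in u i..w i, g x := by
  rw [← Finset.sum_subset (Finset.Icc_subset_Icc_right hj)]
  · refine Finset.sum_congr rfl fun i hi => ?_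
    obtain ⟨hi1, hij⟩ := Finset.mem_Icc.1 hi
    rw [min_eq_left ((h.w_le_w hij hj).trans hv.1), intervalIntegral.integral_of_le
      (h.u_lt_w i (Finset.mem_Icc.2 ⟨hi1, by omega⟩)).le]
  · intro i hi hi'
    simp only [Finset.mem_Icc] at hi hi'
    have h1 : u (j + 1) ≤ u i := by
      rcases (show j + 1 ≤ i by omega).eq_or_lt with he | hlt
      · rw [he]
      · exact (h.u_lt_w _ (Finset.mem_Icc.2 ⟨by omega, by omega⟩)).le.trans
          (h.w_le_u_of_lt hlt (by omega))
    rw [Ioc_eq_empty, setIntegral_empty]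
    exact not_lt.2 ((min_le_right _ _).trans (hv.2.trans h1))

lemma priceAlloc_eq (h : IsIsoRevenueIntervals P0 π J u w) (hP0 : IsValuationLaw P0)
    (hπ : 0 < π) {k : ℝ} (hk : 0 < k) (v : ℝ) : priceAlloc (priceLaw k J u w) v =
      k * ∑ i ∈ Finset.Icc 1 J, ∫ x in Ioc (u i) (min (w i) v), 1 / x := by
  rw [priceAlloc, h.integral_priceLaw hP0 hπ hk,
    ← h.integral_indicator_Iic v (h.integrableOn_inv hP0 hπ), ← integral_const_mul]
  congr 1 with x
  by_cases hx : x ∈ Iic v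
  · rw [indicator_of_mem hx, indicator_of_mem hx]; ring
  · rw [indicator_of_notMem hx, indicator_of_notMem hx]; ring

lemma pricePay_eq (h : IsIsoRevenueIntervals P0 π J u w) (hP0 : IsValuationLaw P0)
    (hπ : 0 < π) {k : ℝ} (hk : 0 < k) (v : ℝ) : pricePay (priceLaw k J u w) v =
      k * ∑ i ∈ Finset.Icc 1 J, ∫ _ in Ioc (u i) (min (w i) v), (1 : ℝ) := by
  rw [pricePay, h.integral_priceLaw hP0 hπ hk, ← h.integral_indicator_Iic v
    (h.integrableOn_of_abs_le hP0 hπ measurable_const (C := 1) (by simp)), ← integral_const_mul]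
  refine setIntegral_congr_fun (measurableSet_intervalUnion J u w) fun x hx => ?_
  have hx0 : x ≠ 0 := (hπ.trans_le (h.intervalUnion_subset hP0 hπ hx).1).ne'
  by_cases hx : x ∈ Iic v
  · simp only [indicator_of_mem hx]
    field_simp
  · simp only [indicator_of_notMem hx]
    ring

lemma isLogMechanism_price (h : IsIsoRevenueIntervals P0 π J u w) (hP0 : IsValuationLaw P0)
    (hπ : 0 < π) {k : ℝ} (hk : 0 < k) (hone : k * ∫ x in intervalUnion J u w, 1 / x = 1) :
    IsLogMechanism k J u w (priceAlloc (priceLaw k J u w)) (pricePay (priceLaw k J u w)) := by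
  have hlog : ∀ j ≤ J, ∑ i ∈ Finset.Icc 1 j, ∫ x in u i..w i, 1 / x =
      ∑ i ∈ Finset.Icc 1 j, Real.log (w i / u i) := fun j hj =>
    Finset.sum_congr rfl fun i hi => by
      have hi' : i ∈ Finset.Icc 1 J := Finset.Icc_subset_Icc_right hj hi
      have h0 := h.u_pos hP0 hπ hi'
      exact integral_one_div_of_pos h0 (h0.trans (h.u_lt_w i hi'))
  -- The valuation 1 lies in no half-open case, so `sum_integral_between` is stated with a closed
  -- right end.
  have hone' : (1 : ℝ) ∈ Icc (w J) (u (J + 1)) := ⟨h.w_le_one le_rfl, h.u_last.ge⟩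
  refine ⟨fun j hj v hv => ?_, fun j hj v hv => ?_, fun j hj v hv => ?_, fun j hj v hv => ?_, ?_, ?_⟩
  · have h0 := h.u_pos hP0 hπ hj
    rw [h.priceAlloc_eq hP0 hπ hk, h.sum_integral_on _ hj hv,
      hlog _ (by have := (Finset.mem_Icc.1 hj).2; omega),
      integral_one_div_of_pos h0 (h0.trans_le hv.1)]
  · rw [h.pricePay_eq hP0 hπ hk, h.sum_integral_on _ hj hv]
    simp only [integral_one]
  · rw [h.priceAlloc_eq hP0 hπ hk, h.sum_integral_between _ hj ⟨hv.1, hv.2.le⟩, hlog j hj]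
  · rw [h.pricePay_eq hP0 hπ hk, h.sum_integral_between _ hj ⟨hv.1, hv.2.le⟩]
    simp only [integral_one]
  · have hU := h.intervalUnion_subset hP0 hπ
    rw [h.priceAlloc_eq hP0 hπ hk, ← h.integral_indicator_Iic 1 (h.integrableOn_inv hP0 hπ)]
    refine Eq.trans ?_ hone
    congr 1
    exact setIntegral_congr_fun (measurableSet_intervalUnion J u w) fun x hx =>
      indicator_of_mem (show x ∈ Iic 1 from (hU hx).2.le) _
  · rw [h.pricePay_eq hP0 hπ hk, h.sum_integral_between _ le_rfl hone']
    simp only [integral_one]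

/-- The randomized price attains the target at the reference law, and its revenue falls by at most
`k` per unit of Wasserstein distance. -/
lemma isFeasible_price (h : IsIsoRevenueIntervals P0 π J u w) (hP0 : IsValuationLaw P0)
    (hπ : 0 < π) {k : ℝ} (hk : 0 < k) (hone : k * ∫ x in intervalUnion J u w, 1 / x = 1) :
    IsFeasible P0 (fragRevenue P0 π k) (priceAlloc (priceLaw k J u w))
      (pricePay (priceLaw k J u w)) k := by
  have hQ := h.isValuationLaw_priceLaw hP0 hπ hk hone
  have hU := h.intervalUnion_subset hP0 hπ
  have hUm := measurableSet_intervalUnion J u w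
  refine ⟨hQ.isMechanism_price, hk, fun P hP => ?_⟩
  have := hP.prob
  have := hP0.prob
  have i0 := h.integrableOn_ccdf hP0 hπ P0
  have iP := h.integrableOn_ccdf hP0 hπ P
  have hrev : k * ∫ x in intervalUnion J u w, ccdf P x ≤
      ∫ v, pricePay (priceLaw k J u w) v ∂P := by
    have hIci : Measurable fun x => P.real (Ici x) :=
      (show Antitone fun x => P.real (Ici x) from
        fun x y hxy => measureReal_mono (Ici_subset_Ici.2 hxy)).measurable
    rw [hQ.integral_pricePay, h.integral_priceLaw hP0 hπ hk, ← integral_const_mul]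
    calc ∫ x in intervalUnion J u w, k * ccdf P x
        ≤ ∫ x in intervalUnion J u w, k * P.real (Ici x) := by
          refine integral_mono (iP.const_mul k) (Integrable.const_mul ?_ k) fun x =>
            mul_le_mul_of_nonneg_left (ccdf_le_real_Ici x) hk.le
          refine h.integrableOn_of_abs_le hP0 hπ hIci (C := 1) fun x _ => ?_
          rw [abs_of_nonneg measureReal_nonneg]
          exact measureReal_le_one
      _ = _ := by
          refine setIntegral_congr_fun hUm fun x hx => ?_
          have hx0 : x ≠ 0 := (hπ.trans_le (hU hx).1).ne'
          field_simp
  have htarget : fragRevenue P0 π k = k * ∫ x in intervalUnion J u w, ccdf P0 x := by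
    have hdiv : ∀ x : ℝ, ccdf P0 x - π / x = ccdf P0 x - π * (1 / x) := fun x => by ring
    rw [fragRevenue, h.isoDist_eq_setIntegral hP0 hπ]
    simp only [hdiv]
    rw [integral_sub i0 ((h.integrableOn_inv hP0 hπ).const_mul π), integral_const_mul]
    -- The term π of ρ cancels k ∫_U π/x, since k ∫_U 1/x = 1.
    linear_combination (-π) * hone
  have hdist : ∫ x in intervalUnion J u w, (ccdf P0 x - ccdf P x) ≤ wdist P P0 := by
    rw [wdist, intervalIntegral.integral_of_le zero_le_one]
    refine (integral_mono (i0.sub iP) (i0.sub iP).abs fun x => le_abs_self _).trans ?_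
    simp only [Pi.sub_apply, abs_sub_comm (ccdf P0 _)]
    refine setIntegral_mono_set ?_ (ae_of_all _ fun x => abs_nonneg _)
      (LE.le.eventuallyLE fun x hx => ⟨hπ.trans_le (hU hx).1, (hU hx).2.le⟩)
    refine Measure.integrableOn_of_bounded (M := 1) (by simp)
      (ccdf_measurable.sub ccdf_measurable).abs.aestronglyMeasurable (ae_of_all _ fun x => ?_)
    rw [Real.norm_eq_abs, abs_abs, abs_le]
    have h1 := ccdf_nonneg P x
    have h2 := ccdf_nonneg P0 x
    have h3 := ccdf_le_one (P := P) x
    have h4 := ccdf_le_one (P := P0) x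
    constructor <;> linarith
  rw [integral_sub i0 iP] at hdist
  have := mul_le_mul_of_nonneg_left hdist hk.le
  rw [htarget]
  linarith

end IsIsoRevenueIntervals

end RobustSatisficing

end

/-! ### Assembly of the theorem -/

open RobustSatisficing

theorem theorem2 (P0 : MeasureTheory.Measure ℝ) (hP0 : RobustSatisficing.IsValuationLaw P0)
    (τ : ℝ) (hτ : 0 < τ) (hτ' : τ < RobustSatisficing.maxRevenue P0) :
    -- `k = (ρ*)⁻¹(τ)` is well defined,
    ∃ k : ℝ, (0 < k ∧ RobustSatisficing.minFragRevenue P0 k = τ) ∧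
      (∀ k' : ℝ, 0 < k' → RobustSatisficing.minFragRevenue P0 k' = τ → k' = k) ∧
      -- `π = π*(k)` is well defined,
      ∃ π : ℝ, RobustSatisficing.IsUniqueArgmin P0 k π ∧
        -- and whenever `P̄₀` and the curve `π/x` agree only on a null set and are separated by
        -- finitely many intervals, the closed form is an optimal mechanism, with fragility `k`
        (MeasureTheory.volume
            {x ∈ Set.Ioc (0 : ℝ) 1 | RobustSatisficing.ccdf P0 x = π / x} = 0 →
          ∀ (J : ℕ) (u w : ℕ → ℝ), RobustSatisficing.IsIsoRevenueIntervals P0 π J u w →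
            ∃ q m : ℝ → ℝ, RobustSatisficing.IsLogMechanism k J u w q m ∧
              RobustSatisficing.IsOptimal P0 τ q m k ∧
              RobustSatisficing.IsRandomizedPrice
                (RobustSatisficing.priceLaw k J u w) q m) := by
  have := hP0.prob
  have hpos : 0 < maxRevenue P0 := hτ.trans hτ'
  obtain ⟨k, hk, hkτ⟩ := exists_pos_minFragRevenue_eq hτ hτ'
  obtain ⟨π, hπ, huniq⟩ := exists_isUniqueArgmin hpos.le hk
  refine ⟨k, ⟨hk, hkτ⟩, fun k' _ hk'τ => ?_, π, ⟨hπ, huniq⟩, fun hnull J u w h => ?_⟩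
  · rcases lt_trichotomy k' k with hlt | heq | hlt
    · have := minFragRevenue_lt_of_lt hpos.le hlt (by rwa [hkτ])
      linarith
    · exact heq
    · have := minFragRevenue_lt_of_lt hpos.le hlt (by rwa [hk'τ])
      linarith
  have hmin : ∀ π' ∈ Set.Icc 0 (maxRevenue P0), fragRevenue P0 π k ≤ fragRevenue P0 π' k :=
    fun π' hπ' => by
      by_cases he : π' = π
      · rw [he]
      · exact (huniq π' hπ' he).le
  have hval : fragRevenue P0 π k = τ := by rw [← minFragRevenue_eq_of_isLeast hπ hmin, hkτ]
  have hdpos := isoDist_pos_of_fragRevenue_lt hπ (by rwa [hval])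
  have hπ0 : 0 < π := argmin_fragRevenue_pos hpos hk hπ.1 hmin
  have hlt_max : π < maxRevenue P0 := by
    refine lt_of_le_of_ne hπ.2 ?_
    rintro rfl
    rw [isoDist_maxRevenue] at hdpos
    exact lt_irrefl _ hdpos
  have hone := first_order_condition hπ0 hlt_max hmin hnull
  rw [h.integral_inv_eq hP0 hπ0 hnull] at hone
  refine ⟨priceAlloc (priceLaw k J u w), pricePay (priceLaw k J u w),
    h.isLogMechanism_price hP0 hπ0 hk hone, ⟨?_, fun q' m' k' h' => ?_⟩,
    ⟨h.isValuationLaw_priceLaw hP0 hπ0 hk hone, fun _ _ => rfl, fun _ _ => rfl⟩⟩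
  · rw [← hval]
    exact h.isFeasible_price hP0 hπ0 hk hone
  · have h1 := h'.target_le_fragRevenue hP0 hπ0
    -- Both slopes are compared at the same level π, where d(π) > 0 can be cancelled.
    rw [← hval, fragRevenue, fragRevenue, add_le_add_iff_left] at h1
    exact le_of_mul_le_mul_right h1 hdpos
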